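/- **Comprehensive Factorization Theorem.** Let $\mathcal C$ be a category with pullbacks and with coequalizers of reflexive pairs (parallel pairs that have a common section), and assume that these coequalizers are stable under pullback in $\mathcal C$. Let $\mathbb T=(T,\eta,\mu)$ be a monad on $\mathcal C$ such that $T$ preserves coequalizers of reflexive pairs (preservation of pullbacks by $T$ is not assumed). Then, in the category $\mathsf{Cat}(\mathbb T)$ of $\mathbb T$-categories and $\mathbb T$-functors, the classes of initial and of perfect $\mathbb T$-functors form an orthogonal factorization system (initial, perfect). That is: both classes are closed under composition with isomorphisms; every $\mathbb T$-functor factors as an initial $\mathbb T$-functor followed by a perfect one; and for every initial $e:X\to Y$, every perfect $n:Z\to W$ and all $a:X\to Z$, $b:Y\to W$ with $b\cdot e=n\cdot a$ there is a unique $w:Y\to Z$ with $w\cdot e=a$ and $n\cdot w=b$. Here the notions are Burroni's. A *$\mathbb T$-category* $A$ consists of objects $A_0,A_1$ and morphisms $d_0:A_1\to TA_0$, $c_0:A_1\to A_0$, $i:A_0\to A_1$ and $m:A_2\to A_1$ of $\mathcal C$, where $A_2=TA_1\times_{TA_0}A_1$ is the pullback of $Tc_0$ and $d_0$ with projections $d_1:A_2\to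 TA_1$, $c_1:A_2\to A_1$, and $A_3=TA_2\times_{TA_1}A_2$ is the pullback of $Tc_1$ and $d_1$ with projections $d_2:A_3\to TA_2$, $c_2:A_3\to A_2$, such that $$d_0 i=\eta_{A_0},\quad c_0 i=1_{A_0},\quad d_0 m=\mu_{A_0}\cdot Td_0\cdot d_1,\quad c_0 m=c_0c_1,\quad m i_1=1_{A_1}=m i_2,\quad m m_1=m m_2 .$$ Here $i_1,i_2:A_1\to A_2$ and $m_1,m_2:A_3\to A_2$ are determined by $d_1i_1=Ti\cdot d_0$, $c_1i_1=1_{A_1}$; $d_1i_2=\eta_{A_1}$, $c_1i_2=i c_0$; $d_1m_1=Tm\cdot d_2$, $c_1m_1=c_1c_2$; $d_1m_2=\mu_{A_1}\cdot Td_1\cdot d_2$, $c_1m_2=m c_2$. A *$\mathbb T$-functor* $f:A\to B$ is a pair of morphisms $f_0:A_0\to B_0$, $f_1:A_1\to B_1$ of $\mathcal C$ with $d_0^Bf_1=Tf_0\cdot d_0^A$, $c_0^Bf_1=f_0c_0^A$, $f_1i^A=i^Bf_0$ and $f_1m^A=m^Bf_2$, where $f_2=Tf_1\times f_1:A_2\to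 B_2$ is the induced morphism. $\mathbb T$-functors are composed componentwise. A $\mathbb T$-functor $f:A\to B$ is *perfect* (a discrete opfibration) if the square $d_0^B\cdot f_1=Tf_0\cdot d_0^A$ is a pullback in $\mathcal C$. It is *initial* if it is left orthogonal to every perfect $\mathbb T$-functor, i.e. has the unique diagonal property above against each perfect $n$. -/

import Mathlib

open CategoryTheory CategoryTheory.Limits

universe v u

namespace Burroni

noncomputable section

/-! ### Orthogonal factorization systems -/

section Factorization

variable {D : Type u} [Category.{v} D]

/-- `e` is (left) orthogonal to `n`: every commutative square `e ≫ b = a ≫ n` has exactly one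
diagonal. -/
def Orthogonal {X Y Z W : D} (e : X ⟶ Y) (n : Z ⟶ W) : Prop :=
  ∀ (a : X ⟶ Z) (b : Y ⟶ W), e ≫ b = a ≫ n → ∃! w : Y ⟶ Z, e ≫ w = a ∧ w ≫ n = b

/-- The class of all morphisms that are left orthogonal to every member of `M`. -/
def leftOrthogonal (M : MorphismProperty D) : MorphismProperty D :=
  fun _ _ e => ∀ ⦃Z W : D⦄ (n : Z ⟶ W), M n → Orthogonal e n

/-- `(E, M)` is an orthogonal factorization system: both classes are closed under composition with
isomorphisms, every morphism is a member of `E` followed by a member of `M`, and every member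
of `E` is left orthogonal to every member of `M`. -/
structure IsOrthogonalFactorizationSystem (E M : MorphismProperty D) : Prop where
  respectsIso_left : E.RespectsIso
  respectsIso_right : M.RespectsIso
  hasFactorization : MorphismProperty.HasFactorization E M
  orthogonal : ∀ ⦃X Y Z W : D⦄ (e : X ⟶ Y) (n : Z ⟶ W), E e → M n → Orthogonal e n

/-- Every coequalizer diagram of a reflexive pair in `D` is stable under pullback. -/
def ReflexiveCoequalizersStableUnderPullback (D : Type u) [Category.{v} D] : Prop :=
  ∀ ⦃X Y : D⦄ (k l : X ⟶ Y) [IsReflexivePair k l] (c : Cofork k l),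
    IsColimit c → IsUniversalColimit c

end Factorization

variable {C : Type u} [Category.{v} C]

/-! ### `T`-graphs -/

/-- A `T`-graph: a span `T A₀ ⟵ A₁ ⟶ A₀`. -/
structure TGraph (T : Monad C) where
  /-- the object of objects -/
  A₀ : C
  /-- the object of morphisms -/
  A₁ : C
  /-- the domain morphism -/
  d₀ : A₁ ⟶ T.obj A₀
  /-- the codomain morphism -/
  c₀ : A₁ ⟶ A₀

/-- A morphism of `T`-graphs. -/
structure TGraph.Hom {T : Monad C} (A B : TGraph T) where
  /-- the object part -/
  f₀ : A.A₀ ⟶ B.A₀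
  /-- the morphism part -/
  f₁ : A.A₁ ⟶ B.A₁
  d₀_comm : f₁ ≫ B.d₀ = A.d₀ ≫ T.map f₀
  c₀_comm : f₁ ≫ B.c₀ = A.c₀ ≫ f₀

variable [HasPullbacks C] {T : Monad C}

namespace TGraph

/-- The object `A₂ = T A₁ ×_{T A₀} A₁` of composable pairs. -/
def A₂ (A : TGraph T) : C := pullback (T.map A.c₀) A.d₀

/-- The first projection `A₂ ⟶ T A₁`. -/
def d₁ (A : TGraph T) : A.A₂ ⟶ T.obj A.A₁ := pullback.fst (T.map A.c₀) A.d₀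

/-- The second projection `A₂ ⟶ A₁`. -/
def c₁ (A : TGraph T) : A.A₂ ⟶ A.A₁ := pullback.snd (T.map A.c₀) A.d₀

theorem isPullback_A₂ (A : TGraph T) : IsPullback A.d₁ A.c₁ (T.map A.c₀) A.d₀ :=
  IsPullback.of_hasPullback _ _

/-- The object `A₃ = T A₂ ×_{T A₁} A₂` of composable triples. -/
def A₃ (A : TGraph T) : C := pullback (T.map A.c₁) A.d₁

/-- The first projection `A₃ ⟶ T A₂`. -/
def d₂ (A : TGraph T) : A.A₃ ⟶ T.obj A.A₂ := pullback.fst (T.map A.c₁) A.d₁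

/-- The second projection `A₃ ⟶ A₂`. -/
def c₂ (A : TGraph T) : A.A₃ ⟶ A.A₂ := pullback.snd (T.map A.c₁) A.d₁

theorem isPullback_A₃ (A : TGraph T) : IsPullback A.d₂ A.c₂ (T.map A.c₁) A.d₁ :=
  IsPullback.of_hasPullback _ _

/-- The morphism `f₂ = T f₁ × f₁ : A₂ ⟶ B₂` induced by a morphism of `T`-graphs. -/
def Hom.f₂ {A B : TGraph T} (f : Hom A B) : A.A₂ ⟶ B.A₂ :=
  B.isPullback_A₂.lift (A.d₁ ≫ T.map f.f₁) (A.c₁ ≫ f.f₁) (by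
    rw [Category.assoc, Category.assoc, ← T.map_comp, f.c₀_comm, f.d₀_comm, T.map_comp,
      reassoc_of% A.isPullback_A₂.w])

end TGraph

/-! ### Pointed `T`-graphs -/

/-- A pointed `T`-graph: a `T`-graph with an insertion of identities. -/
structure PointedTGraph (T : Monad C) extends TGraph T where
  /-- the insertion of identities -/
  i : A₀ ⟶ A₁
  i_d₀ : i ≫ d₀ = T.η.app A₀
  i_c₀ : i ≫ c₀ = 𝟙 A₀

namespace PointedTGraph

/-- `i₁ = T i × 1 : A₁ ⟶ A₂`. -/
def i₁ (A : PointedTGraph T) : A.A₁ ⟶ A.A₂ :=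
  A.isPullback_A₂.lift (A.d₀ ≫ T.map A.i) (𝟙 A.A₁) (by
    rw [Category.assoc, ← T.map_comp, A.i_c₀, T.map_id, Category.comp_id, Category.id_comp])

/-- `i₂ = η × i : A₁ ⟶ A₂`. -/
def i₂ (A : PointedTGraph T) : A.A₁ ⟶ A.A₂ :=
  A.isPullback_A₂.lift (T.η.app A.A₁) (A.c₀ ≫ A.i) (by
    rw [Category.assoc, A.i_d₀]
    exact (T.η.naturality A.c₀).symm)

end PointedTGraph

/-! ### `T`-categories -/

/-- A pointed `T`-graph with a composition morphism `m : A₂ ⟶ A₁` that is compatible with domains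
and codomains; no neutrality or associativity is required yet. -/
structure PreTCat (T : Monad C) extends PointedTGraph T where
  /-- the composition morphism -/
  m : toTGraph.A₂ ⟶ A₁
  m_d₀ : m ≫ d₀ = toTGraph.d₁ ≫ T.map d₀ ≫ T.μ.app A₀
  m_c₀ : m ≫ c₀ = toTGraph.c₁ ≫ c₀

namespace PreTCat

/-- `m₁ = T m × c₁ : A₃ ⟶ A₂`. -/
def m₁ (A : PreTCat T) : A.A₃ ⟶ A.A₂ :=
  A.isPullback_A₂.lift (A.d₂ ≫ T.map A.m) (A.c₂ ≫ A.c₁) (by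
    rw [Category.assoc, Category.assoc, ← T.map_comp, A.m_c₀, T.map_comp,
      reassoc_of% A.isPullback_A₃.w, A.isPullback_A₂.w])

/-- `m₂ = (μ · T d₁) × m : A₃ ⟶ A₂`. -/
def m₂ (A : PreTCat T) : A.A₃ ⟶ A.A₂ :=
  A.isPullback_A₂.lift (A.d₂ ≫ T.map A.d₁ ≫ T.μ.app A.A₁) (A.c₂ ≫ A.m) (by
    have h := T.μ.naturality A.c₀
    simp only [Functor.comp_map] at h
    simp only [Category.assoc]
    rw [← h, ← T.map_comp_assoc, A.isPullback_A₂.w, A.m_d₀, T.map_comp,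
      ← reassoc_of% A.isPullback_A₃.w, Category.assoc])

end PreTCat

/-- A `T`-category. -/
structure TCat (T : Monad C) extends PreTCat T where
  i₁_m : toPreTCat.i₁ ≫ m = 𝟙 A₁
  i₂_m : toPreTCat.i₂ ≫ m = 𝟙 A₁
  assoc : toPreTCat.m₁ ≫ m = toPreTCat.m₂ ≫ m

/-- A `T`-functor: a morphism of `T`-graphs that preserves identities and composition. -/
@[ext]
structure TFunctor (A B : TCat T) extends TGraph.Hom A.toTGraph B.toTGraph where
  map_i : A.i ≫ f₁ = f₀ ≫ B.i
  map_m : A.m ≫ f₁ = toHom.f₂ ≫ B.m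

namespace TFunctor

/-- The identity `T`-functor. -/
def id (A : TCat T) : TFunctor A A where
  f₀ := 𝟙 _
  f₁ := 𝟙 _
  d₀_comm := by simp
  c₀_comm := by simp
  map_i := by simp
  map_m := by
    rw [Category.comp_id]
    convert (Category.id_comp A.m).symm using 2
    apply A.isPullback_A₂.hom_ext <;> simp [TGraph.Hom.f₂]

/-- The composite of two `T`-functors. -/
def comp {A B E : TCat T} (f : TFunctor A B) (g : TFunctor B E) : TFunctor A E where
  f₀ := f.f₀ ≫ g.f₀
  f₁ := f.f₁ ≫ g.f₁
  d₀_comm := by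
    rw [Category.assoc, g.d₀_comm, reassoc_of% f.d₀_comm, T.map_comp]
  c₀_comm := by
    rw [Category.assoc, g.c₀_comm, reassoc_of% f.c₀_comm]
  map_i := by
    rw [reassoc_of% f.map_i, g.map_i, Category.assoc]
  map_m := by
    rw [reassoc_of% f.map_m, g.map_m, ← Category.assoc]
    congr 1
    apply E.isPullback_A₂.hom_ext <;> simp [TGraph.Hom.f₂]

end TFunctor

/-- The category `Cat(T)` of `T`-categories and `T`-functors. -/
instance : Category (TCat T) where
  Hom := TFunctor
  id := TFunctor.id
  comp := TFunctor.comp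
  id_comp f := by apply TFunctor.ext <;> exact Category.id_comp _
  comp_id f := by apply TFunctor.ext <;> exact Category.comp_id _
  assoc f g h := by apply TFunctor.ext <;> exact Category.assoc _ _ _

/-- The class of perfect `T`-functors (discrete opfibrations) in `Cat(T)`. -/
def perfect (T : Monad C) : MorphismProperty (TCat T) :=
  fun A B (f : TFunctor A B) => IsPullback A.d₀ f.f₁ (T.map f.f₀) B.d₀

/-- The class of initial `T`-functors: those left orthogonal to all perfect `T`-functors. -/
def initial (T : Monad C) : MorphismProperty (TCat T) :=
  leftOrthogonal (perfect T)

end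

end Burroni

/-!
For a `T`-category `B`, objects `x : X ⟶ B₀` over `B₀` carry a monad `B.fam`, with
`B.fam x = T X ×_{T B₀} B₁` over `B₀` by the codomain. Its unit and multiplication come from the
identities and the composition of `B`. Perfect `T`-functors into `B` are the algebras of this monad:
only the construction of a perfect `T`-functor from an algebra (`TCat.Action.total`,
`TCat.Action.perfect_proj`) is needed. A `T`-graph with a unit and a composition that lies over `B`
by such a pullback is automatically a `T`-category, since its morphisms are determined by their
domain and their image in `B`.

A `T`-functor `f : A ⟶ B` gives a reflexive pair `f.relCod, f.relDom` from `B.fam (c₀ ≫ f₀)` to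
`B.fam f₀`: a family `α` of morphisms of `A` and a composable morphism `β` of `B` are sent to
`(cod α, β)` and to `(dom α, f α ≫ β)`. Both are morphisms of free algebras. As `T` preserves
reflexive coequalizers and these are stable under pullback, `B.fam` preserves them
(`TCat.nonempty_isColimit_famMap`), although `T` need not preserve pullbacks. So the coequalizer
`f.components` inherits an algebra structure (`TFunctor.freeAction`), and `f` factors through the
perfect `T`-functor of this algebra (`TFunctor.factorInitial_comp_factorPerfect`).

It remains to see that the first factor is initial. A `T`-functor `f : A ⟶ B` is initial as soon as
`B₀` itself is the coequalizer of `f.relCod` and `f.relDom` through the codomain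
(`TFunctor.initial_of_isColimit`). Indeed, for a perfect `n : Z ⟶ W` and a square from `f` to `n`,
pairs `(a, β : f a ⟶ b)` lift uniquely to `Z₁`; the codomain of the lift defines the diagonal on
objects, perfectness of `n` defines it on morphisms, and compatibility with codomains holds after
composition with the epimorphism obtained by applying `B.fam` to the coequalizer. The first
factor satisfies the criterion because `P.fam e₀` is isomorphic to `B.fam f₀` when `f` is
`e : A ⟶ P` followed by a perfect `T`-functor (`TCat.isIso_famPush`).
-/

namespace Burroni

noncomputable section

variable {C : Type u} [Category.{v} C] [HasPullbacks C] {T : Monad C}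

/-! ### Composition of generalized elements -/

namespace TCat

/-- The composite of a generalized element `t` of `B₁` with a generalized element `s` of `T B₁`
whose codomain is the domain of `t`. -/
def compose (B : TCat T) {S : C} (s : S ⟶ T.obj B.A₁) (t : S ⟶ B.A₁)
    (h : s ≫ T.map B.c₀ = t ≫ B.d₀) : S ⟶ B.A₁ :=
  B.isPullback_A₂.lift s t h ≫ B.m

section Compose

variable (B : TCat T) {S : C} (s : S ⟶ T.obj B.A₁) (t : S ⟶ B.A₁)
  (h : s ≫ T.map B.c₀ = t ≫ B.d₀)

@[simp]
theorem compose_d₀ : B.compose s t h ≫ B.d₀ = s ≫ T.map B.d₀ ≫ T.μ.app B.A₀ := by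
  rw [compose, Category.assoc, B.m_d₀, IsPullback.lift_fst_assoc]

@[simp]
theorem compose_c₀ : B.compose s t h ≫ B.c₀ = t ≫ B.c₀ := by
  rw [compose, Category.assoc, B.m_c₀, IsPullback.lift_snd_assoc]

theorem comp_compose {S' : C} (g : S' ⟶ S) :
    g ≫ B.compose s t h = B.compose (g ≫ s) (g ≫ t) (by simp only [Category.assoc, h]) := by
  rw [compose, compose, ← Category.assoc]
  congr 1
  apply B.isPullback_A₂.hom_ext <;> simp

theorem compose_congr {s s' : S ⟶ T.obj B.A₁} {t t' : S ⟶ B.A₁} (hs : s = s') (ht : t = t')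
    (h : s ≫ T.map B.c₀ = t ≫ B.d₀) :
    B.compose s t h = B.compose s' t' (by rw [← hs, ← ht, h]) := by
  subst hs ht
  rfl

theorem compose_map {E : TCat T} (f : TFunctor B E) :
    B.compose s t h ≫ f.f₁ = E.compose (s ≫ T.map f.f₁) (t ≫ f.f₁) (by
      rw [Category.assoc, Category.assoc, ← T.map_comp, f.c₀_comm, f.d₀_comm, T.map_comp,
        reassoc_of% h]) := by
  rw [compose, compose, Category.assoc, f.map_m, ← Category.assoc]
  congr 1
  apply E.isPullback_A₂.hom_ext <;> simp [TGraph.Hom.f₂]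

theorem i_compose :
    B.compose (t ≫ B.d₀ ≫ T.map B.i) t (by
      simp only [Category.assoc, ← T.map_comp, B.i_c₀, T.map_id, Category.comp_id]) = t := by
  conv_rhs => rw [← Category.comp_id t, ← B.i₁_m, ← Category.assoc]
  rw [compose]
  congr 1
  apply B.isPullback_A₂.hom_ext <;> simp [PointedTGraph.i₁]

theorem compose_i :
    B.compose (t ≫ T.η.app B.A₁) (t ≫ B.c₀ ≫ B.i) (by
      have := T.η.naturality B.c₀
      simp only [Functor.id_map] at this
      simp only [Category.assoc, B.i_d₀, this]) = t := by
  conv_rhs => rw [← Category.comp_id t, ← B.i₂_m, ← Category.assoc]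
  rw [compose]
  congr 1
  apply B.isPullback_A₂.hom_ext <;> simp [PointedTGraph.i₂]

/-- Associativity for generalized elements. As `T` need not preserve pullbacks, the two inner
families have to be given as the image under `T` of a composable pair at some stage `Y`. -/
theorem compose_assoc {Y : C} (r : Y ⟶ B.A₁)
    (p : Y ⟶ T.obj B.A₁) (hp : p ≫ T.map B.c₀ = r ≫ B.d₀) (t : S ⟶ T.obj Y) (s : S ⟶ B.A₁)
    (ht : t ≫ T.map (r ≫ B.c₀) = s ≫ B.d₀) :
    B.compose (t ≫ T.map (B.compose p r hp)) s (by
        rw [Category.assoc, ← T.map_comp, compose_c₀, ht]) =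
      B.compose (t ≫ T.map p ≫ T.μ.app B.A₁) (B.compose (t ≫ T.map r) s (by
        rw [Category.assoc, ← T.map_comp, ht])) (by
        have := T.μ.naturality B.c₀
        simp only [Functor.comp_map] at this
        simp only [Category.assoc, compose_d₀, ← this]
        rw [← T.map_comp_assoc, hp, T.map_comp_assoc]) := by
  let y : Y ⟶ B.A₂ := B.isPullback_A₂.lift p r hp
  let z : S ⟶ B.A₂ := B.isPullback_A₂.lift (t ≫ T.map r) s (by
    rw [Category.assoc, ← T.map_comp, ht])
  let x : S ⟶ B.A₃ := B.isPullback_A₃.lift (t ≫ T.map y) z (by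
    simp [y, z, ← T.map_comp])
  have hx := x ≫= B.assoc
  simp only [← Category.assoc] at hx
  convert hx using 1
  · rw [compose]
    congr 1
    apply B.isPullback_A₂.hom_ext <;> simp [PreTCat.m₁, x, y, z, compose]
  · rw [compose]
    congr 1
    apply B.isPullback_A₂.hom_ext <;> simp [PreTCat.m₂, x, y, z, compose, ← T.map_comp_assoc]

end Compose

/-! ### Families of morphisms with domain in an object over `B₀` -/

variable (B : TCat T)

/-- For `x : X ⟶ B₀`, the pullback `T X ×_{T B₀} B₁`. Its elements are the morphisms `β` of `B`
together with an element `t` of `T X` lying over the domain of `β`. -/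
def fam {X : C} (x : X ⟶ B.A₀) : C := pullback (T.map x) B.d₀

/-- The component in `T X` of an element of `B.fam x`. -/
def src {X : C} (x : X ⟶ B.A₀) : B.fam x ⟶ T.obj X := pullback.fst _ _

/-- The morphism of `B` underlying an element of `B.fam x`. -/
def arr {X : C} (x : X ⟶ B.A₀) : B.fam x ⟶ B.A₁ := pullback.snd _ _

/-- The codomain of an element of `B.fam x`; it makes `B.fam x` an object over `B₀`. -/
def tgt {X : C} (x : X ⟶ B.A₀) : B.fam x ⟶ B.A₀ := B.arr x ≫ B.c₀

theorem isPullback_fam {X : C} (x : X ⟶ B.A₀) :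
    IsPullback (B.src x) (B.arr x) (T.map x) B.d₀ :=
  IsPullback.of_hasPullback _ _

theorem fam_w {X : C} (x : X ⟶ B.A₀) : B.src x ≫ T.map x = B.arr x ≫ B.d₀ :=
  (B.isPullback_fam x).w

/-- The element of `B.fam x` with given components. -/
def famLift {X S : C} (x : X ⟶ B.A₀) (t : S ⟶ T.obj X) (b : S ⟶ B.A₁)
    (h : t ≫ T.map x = b ≫ B.d₀) : S ⟶ B.fam x :=
  (B.isPullback_fam x).lift t b h

section Fam

variable {X Y S : C}

@[simp]
theorem famLift_src (x : X ⟶ B.A₀) (t : S ⟶ T.obj X) (b : S ⟶ B.A₁)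
    (h : t ≫ T.map x = b ≫ B.d₀) : B.famLift x t b h ≫ B.src x = t :=
  (B.isPullback_fam x).lift_fst _ _ _

@[simp]
theorem famLift_arr (x : X ⟶ B.A₀) (t : S ⟶ T.obj X) (b : S ⟶ B.A₁)
    (h : t ≫ T.map x = b ≫ B.d₀) : B.famLift x t b h ≫ B.arr x = b :=
  (B.isPullback_fam x).lift_snd _ _ _

theorem fam_ext {x : X ⟶ B.A₀} {s t : S ⟶ B.fam x} (h : s ≫ B.src x = t ≫ B.src x)
    (h' : s ≫ B.arr x = t ≫ B.arr x) : s = t :=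
  (B.isPullback_fam x).hom_ext h h'

/-- Functoriality of `B.fam` on objects over `B₀`. -/
def famMap {x : X ⟶ B.A₀} {y : Y ⟶ B.A₀} (g : X ⟶ Y) (h : g ≫ y = x) : B.fam x ⟶ B.fam y :=
  B.famLift y (B.src x ≫ T.map g) (B.arr x) (by
    rw [Category.assoc, ← T.map_comp, h, B.fam_w])

@[simp]
theorem famMap_src {x : X ⟶ B.A₀} {y : Y ⟶ B.A₀} (g : X ⟶ Y) (h : g ≫ y = x) :
    B.famMap g h ≫ B.src y = B.src x ≫ T.map g :=
  B.famLift_src _ _ _ _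

@[simp]
theorem famMap_src_assoc {x : X ⟶ B.A₀} {y : Y ⟶ B.A₀} (g : X ⟶ Y) (h : g ≫ y = x)
    {Z : C} (k : T.obj Y ⟶ Z) :
    B.famMap g h ≫ B.src y ≫ k = B.src x ≫ T.map g ≫ k := by
  simpa only [Category.assoc] using B.famMap_src g h =≫ k

@[simp]
theorem famMap_arr {x : X ⟶ B.A₀} {y : Y ⟶ B.A₀} (g : X ⟶ Y) (h : g ≫ y = x) :
    B.famMap g h ≫ B.arr y = B.arr x :=
  B.famLift_arr _ _ _ _

@[simp]
theorem famMap_arr_assoc {x : X ⟶ B.A₀} {y : Y ⟶ B.A₀} (g : X ⟶ Y) (h : g ≫ y = x)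
    {Z : C} (k : B.A₁ ⟶ Z) :
    B.famMap g h ≫ B.arr y ≫ k = B.arr x ≫ k := by
  rw [← Category.assoc, famMap_arr]

@[simp]
theorem famMap_tgt {x : X ⟶ B.A₀} {y : Y ⟶ B.A₀} (g : X ⟶ Y) (h : g ≫ y = x) :
    B.famMap g h ≫ B.tgt y = B.tgt x := by
  simp [tgt]

theorem famMap_comp {Z : C} {x : X ⟶ B.A₀} {y : Y ⟶ B.A₀} {z : Z ⟶ B.A₀} (g : X ⟶ Y)
    (h : g ≫ y = x) (g' : Y ⟶ Z) (h' : g' ≫ z = y) :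
    B.famMap g h ≫ B.famMap g' h' =
      B.famMap (g ≫ g') (by rw [Category.assoc, h', h]) := by
  apply fam_ext <;> simp

theorem famMap_id {x : X ⟶ B.A₀} (g : X ⟶ X) (h : g ≫ x = x) (hg : g = 𝟙 X) :
    B.famMap g h = 𝟙 _ := by
  subst hg
  apply fam_ext <;> simp

theorem famMap_congr {x : X ⟶ B.A₀} {y : Y ⟶ B.A₀} {g g' : X ⟶ Y} (hg : g = g')
    (h : g ≫ y = x) : B.famMap g h = B.famMap g' (hg ▸ h) := by
  subst hg
  rfl

/-- The unit `X ⟶ B.fam x` of the monad `B.fam` on objects over `B₀`: identities of `B`. -/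
def famUnit (x : X ⟶ B.A₀) : X ⟶ B.fam x :=
  B.famLift x (T.η.app X) (x ≫ B.i) (by
    rw [Category.assoc, B.i_d₀]
    exact (T.η.naturality x).symm)

@[simp]
theorem famUnit_src (x : X ⟶ B.A₀) : B.famUnit x ≫ B.src x = T.η.app X := B.famLift_src _ _ _ _

@[simp]
theorem famUnit_src_assoc (x : X ⟶ B.A₀) {Z : C} (g : T.obj X ⟶ Z) :
    B.famUnit x ≫ B.src x ≫ g = T.η.app X ≫ g := by
  rw [← Category.assoc, famUnit_src]

@[simp]
theorem famUnit_arr (x : X ⟶ B.A₀) : B.famUnit x ≫ B.arr x = x ≫ B.i := B.famLift_arr _ _ _ _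

@[simp]
theorem famUnit_arr_assoc (x : X ⟶ B.A₀) {Z : C} (g : B.A₁ ⟶ Z) :
    B.famUnit x ≫ B.arr x ≫ g = x ≫ B.i ≫ g := by
  simpa only [Category.assoc] using B.famUnit_arr x =≫ g

@[simp]
theorem famUnit_tgt (x : X ⟶ B.A₀) : B.famUnit x ≫ B.tgt x = x := by
  simp [tgt, B.i_c₀]

theorem famMult_aux (x : X ⟶ B.A₀) :
    (B.src (B.tgt x) ≫ T.map (B.arr x)) ≫ T.map B.c₀ = B.arr (B.tgt x) ≫ B.d₀ := by
  rw [Category.assoc, ← T.map_comp]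
  exact B.fam_w (B.tgt x)

/-- The multiplication of the monad `B.fam` on objects over `B₀`: composition in `B`. -/
def famMult (x : X ⟶ B.A₀) : B.fam (B.tgt x) ⟶ B.fam x :=
  B.famLift x (B.src (B.tgt x) ≫ T.map (B.src x) ≫ T.μ.app X)
    (B.compose (B.src (B.tgt x) ≫ T.map (B.arr x)) (B.arr (B.tgt x)) (B.famMult_aux x)) (by
      have := T.μ.naturality x
      simp only [Functor.comp_map] at this
      simp only [compose_d₀, Category.assoc]
      rw [← this, ← T.map_comp_assoc, B.fam_w, T.map_comp_assoc])

@[simp]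
theorem famMult_src (x : X ⟶ B.A₀) :
    B.famMult x ≫ B.src x = B.src (B.tgt x) ≫ T.map (B.src x) ≫ T.μ.app X :=
  B.famLift_src _ _ _ _

@[simp]
theorem famMult_src_assoc (x : X ⟶ B.A₀) {Z : C} (g : T.obj X ⟶ Z) :
    B.famMult x ≫ B.src x ≫ g = B.src (B.tgt x) ≫ T.map (B.src x) ≫ T.μ.app X ≫ g := by
  simpa only [Category.assoc] using B.famMult_src x =≫ g

@[simp]
theorem famMult_arr (x : X ⟶ B.A₀) :
    B.famMult x ≫ B.arr x =
      B.compose (B.src (B.tgt x) ≫ T.map (B.arr x)) (B.arr (B.tgt x)) (B.famMult_aux x) :=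
  B.famLift_arr _ _ _ _

@[simp]
theorem famMult_arr_assoc (x : X ⟶ B.A₀) {Z : C} (g : B.A₁ ⟶ Z) :
    B.famMult x ≫ B.arr x ≫ g =
      B.compose (B.src (B.tgt x) ≫ T.map (B.arr x)) (B.arr (B.tgt x)) (B.famMult_aux x) ≫ g := by
  rw [← Category.assoc, famMult_arr]

@[simp]
theorem famMult_tgt (x : X ⟶ B.A₀) : B.famMult x ≫ B.tgt x = B.tgt (B.tgt x) :=
  (B.famMult_arr_assoc x B.c₀).trans (B.compose_c₀ _ _ _)

theorem famUnit_naturality {x : X ⟶ B.A₀} {y : Y ⟶ B.A₀} (g : X ⟶ Y) (h : g ≫ y = x) :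
    B.famUnit x ≫ B.famMap g h = g ≫ B.famUnit y := by
  apply fam_ext
  · simpa using (T.η.naturality g).symm
  · simp [← h]

theorem famMult_naturality {x : X ⟶ B.A₀} {y : Y ⟶ B.A₀} (g : X ⟶ Y) (h : g ≫ y = x) :
    B.famMap (B.famMap g h) (B.famMap_tgt g h) ≫ B.famMult y = B.famMult x ≫ B.famMap g h := by
  apply fam_ext
  · have := T.μ.naturality g
    simp only [Functor.comp_map] at this
    simp only [Category.assoc, famMult_src, famMap_src, famMap_src_assoc, famMult_src_assoc, ← this]
    rw [← T.map_comp_assoc, famMap_src, T.map_comp_assoc]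
  · simp only [Category.assoc, famMult_arr, comp_compose, famMap_arr]
    apply compose_congr
    · rw [famMap_src_assoc, ← T.map_comp, famMap_arr]
    · rfl

@[simp]
theorem famUnit_famMult (x : X ⟶ B.A₀) : B.famUnit (B.tgt x) ≫ B.famMult x = 𝟙 _ := by
  apply fam_ext
  · have := T.η.naturality (B.src x)
    simp only [Functor.id_map] at this
    simp [← reassoc_of% this]
  · have := T.η.naturality (B.arr x)
    simp only [Functor.id_map] at this
    simp only [Category.assoc, famMult_arr, comp_compose, Category.id_comp]
    refine (B.compose_congr ?_ ?_ _).trans (B.compose_i (B.arr x))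
    · simp [← this]
    · simp [tgt]

@[simp]
theorem famMap_famUnit_famMult (x : X ⟶ B.A₀) :
    B.famMap (B.famUnit x) (B.famUnit_tgt x) ≫ B.famMult x = 𝟙 _ := by
  apply fam_ext
  · simp [← T.map_comp_assoc]
  · simp only [Category.assoc, famMult_arr, comp_compose, Category.id_comp]
    refine (B.compose_congr ?_ ?_ _).trans (B.i_compose (B.arr x))
    · rw [famMap_src_assoc, ← T.map_comp, famUnit_arr, T.map_comp, reassoc_of% B.fam_w x]
    · simp

theorem famMult_famMult (x : X ⟶ B.A₀) :
    B.famMap (B.famMult x) (B.famMult_tgt x) ≫ B.famMult x =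
      B.famMult (B.tgt x) ≫ B.famMult x := by
  apply fam_ext
  · have := T.μ.naturality (B.src x)
    simp only [Functor.comp_map] at this
    simp only [Category.assoc, famMult_src, famMap_src_assoc, famMult_src_assoc, ← T.map_comp_assoc]
    simp [T.assoc, ← reassoc_of% this]
  · simp only [Category.assoc, famMult_arr, comp_compose]
    have key := B.compose_assoc (B.arr (B.tgt x)) (B.src (B.tgt x) ≫ T.map (B.arr x))
      (B.famMult_aux x) (B.src (B.tgt (B.tgt x))) (B.arr (B.tgt (B.tgt x))) (B.fam_w _)
    refine (B.compose_congr ?_ ?_ _).trans (key.trans (B.compose_congr ?_ ?_ _))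
    · rw [famMap_src_assoc, ← T.map_comp, famMult_arr]
    · simp
    · have := T.μ.naturality (B.arr x)
      simp only [Functor.comp_map] at this
      simp [← this]
    · rfl

end Fam

end TCat

/-! ### Perfect `T`-functors -/

namespace TCat

theorem perfect_hom_ext {Z W : TCat T} {n : TFunctor Z W} (hn : perfect T n) {S : C}
    {s t : S ⟶ Z.A₁} (h : s ≫ Z.d₀ = t ≫ Z.d₀) (h' : s ≫ n.f₁ = t ≫ n.f₁) : s = t :=
  IsPullback.hom_ext hn h h'

/-- A morphism of `T`-graphs whose composite with a perfect `T`-functor is a `T`-functor is itself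
a `T`-functor. -/
def functorOfPerfect {Y Z W : TCat T} {n : TFunctor Z W} (hn : perfect T n) (b : TFunctor Y W)
    (w : TGraph.Hom Y.toTGraph Z.toTGraph) (h₀ : w.f₀ ≫ n.f₀ = b.f₀) (h₁ : w.f₁ ≫ n.f₁ = b.f₁) :
    TFunctor Y Z where
  toHom := w
  map_i := by
    apply perfect_hom_ext hn
    · simp only [Category.assoc, w.d₀_comm, Z.i_d₀, reassoc_of% Y.i_d₀]
      exact (T.η.naturality w.f₀).symm
    · rw [Category.assoc, h₁, b.map_i, Category.assoc, n.map_i, reassoc_of% h₀]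
  map_m := by
    have hf : w.f₂ ≫ n.f₂ = b.f₂ := by
      apply W.isPullback_A₂.hom_ext <;> simp [TGraph.Hom.f₂, ← T.map_comp, h₁]
    apply perfect_hom_ext hn
    · have := T.μ.naturality w.f₀
      simp only [Functor.comp_map] at this
      simp only [Category.assoc, w.d₀_comm, Z.m_d₀, reassoc_of% Y.m_d₀, ← this]
      simp only [TGraph.Hom.f₂, IsPullback.lift_fst_assoc, Category.assoc, ← T.map_comp_assoc,
        w.d₀_comm]
    · rw [Category.assoc, h₁, b.map_m, Category.assoc, n.map_m, reassoc_of% hf]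

/-! ### Algebras for the monad `B.fam` and their `T`-categories of elements -/

/-- An algebra for the monad `B.fam` on objects over `B₀`: an object over `B₀` on which the
morphisms of `B` act. -/
structure Action (B : TCat T) where
  /-- the underlying object -/
  pt : C
  /-- the structure morphism to `B₀` -/
  hom : pt ⟶ B.A₀
  /-- the action of the morphisms of `B` -/
  act : B.fam hom ⟶ pt
  act_hom : act ≫ hom = B.tgt hom
  unit_act : B.famUnit hom ≫ act = 𝟙 pt
  mult_act : B.famMult hom ≫ act = B.famMap act act_hom ≫ act

namespace Action

variable {B : TCat T} (P : B.Action)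

/-- The pointed `T`-graph of elements of an action. -/
abbrev pointed : PointedTGraph T where
  A₀ := P.pt
  A₁ := B.fam P.hom
  d₀ := B.src P.hom
  c₀ := P.act
  i := B.famUnit P.hom
  i_d₀ := B.famUnit_src _
  i_c₀ := P.unit_act

/-- A composable pair of elements, seen as a family of families of morphisms of `B`. -/
def pair : P.pointed.A₂ ⟶ B.fam (B.tgt P.hom) :=
  B.famLift (B.tgt P.hom) P.pointed.d₁ (P.pointed.c₁ ≫ B.arr P.hom) (by
    have := P.pointed.isPullback_A₂.w
    simp only [pointed] at this
    rw [← P.act_hom, T.map_comp, reassoc_of% this, Category.assoc, B.fam_w])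

theorem pair_src : P.pair ≫ B.src (B.tgt P.hom) = P.pointed.d₁ := B.famLift_src _ _ _ _

theorem pair_arr : P.pair ≫ B.arr (B.tgt P.hom) = P.pointed.c₁ ≫ B.arr P.hom :=
  B.famLift_arr _ _ _ _

theorem pair_famMap_act : P.pair ≫ B.famMap P.act P.act_hom = P.pointed.c₁ := by
  apply B.fam_ext
  · rw [Category.assoc, B.famMap_src, ← Category.assoc, pair_src]
    exact P.pointed.isPullback_A₂.w
  · rw [Category.assoc, B.famMap_arr, pair_arr]

/-- The `T`-graph of elements of an action, with its identities and its composition. -/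
abbrev preCat : PreTCat T where
  toPointedTGraph := P.pointed
  m := P.pair ≫ B.famMult P.hom
  m_d₀ := by
    change (P.pair ≫ B.famMult P.hom) ≫ B.src P.hom = P.pointed.d₁ ≫ T.map (B.src P.hom) ≫ _
    rw [Category.assoc, famMult_src, reassoc_of% P.pair_src]
  m_c₀ := by
    change (P.pair ≫ B.famMult P.hom) ≫ P.act = P.pointed.c₁ ≫ P.act
    rw [Category.assoc, P.mult_act, reassoc_of% P.pair_famMap_act]

/-- A composable triple of elements, seen as a threefold family of morphisms of `B`. -/
def triple : P.pointed.A₃ ⟶ B.fam (B.tgt (B.tgt P.hom)) :=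
  B.famLift _ (P.pointed.d₂ ≫ T.map P.pair) (P.pointed.c₂ ≫ P.pointed.c₁ ≫ B.arr P.hom) (by
    have h := P.pointed.isPullback_A₃.w
    have h' := P.pointed.isPullback_A₂.w
    simp only [pointed] at h h'
    have e : P.pair ≫ B.tgt (B.tgt P.hom) = P.pointed.c₁ ≫ P.act ≫ P.hom := by
      rw [← B.famMap_tgt P.act P.act_hom, reassoc_of% P.pair_famMap_act, P.act_hom]
    rw [Category.assoc, ← T.map_comp, e, T.map_comp, reassoc_of% h, T.map_comp, reassoc_of% h']
    simp only [Category.assoc, B.fam_w])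

theorem triple_src :
    P.triple ≫ B.src (B.tgt (B.tgt P.hom)) = P.pointed.d₂ ≫ T.map P.pair :=
  B.famLift_src _ _ _ _

theorem triple_arr :
    P.triple ≫ B.arr (B.tgt (B.tgt P.hom)) = P.pointed.c₂ ≫ P.pointed.c₁ ≫ B.arr P.hom :=
  B.famLift_arr _ _ _ _

/-- The `T`-category of elements of an action. -/
abbrev total : TCat T where
  toPreTCat := P.preCat
  i₁_m := by
    change P.pointed.i₁ ≫ P.pair ≫ B.famMult P.hom = 𝟙 _
    have h : P.pointed.i₁ ≫ P.pair = B.famMap (B.famUnit P.hom) (B.famUnit_tgt P.hom) := by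
      apply B.fam_ext
      · rw [Category.assoc, pair_src, famMap_src]
        exact IsPullback.lift_fst _ _ _ _
      · rw [Category.assoc, pair_arr, famMap_arr]
        exact (IsPullback.lift_snd_assoc _ _ _ _ _).trans (Category.id_comp _)
    rw [reassoc_of% h, famMap_famUnit_famMult]
  i₂_m := by
    change P.pointed.i₂ ≫ P.pair ≫ B.famMult P.hom = 𝟙 _
    have h : P.pointed.i₂ ≫ P.pair = B.famUnit (B.tgt P.hom) := by
      apply B.fam_ext
      · rw [Category.assoc, pair_src, famUnit_src]
        exact IsPullback.lift_fst _ _ _ _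
      · rw [Category.assoc, pair_arr, famUnit_arr]
        refine (IsPullback.lift_snd_assoc _ _ _ _ _).trans ?_
        simp only [pointed, Category.assoc, famUnit_arr, reassoc_of% P.act_hom]
    rw [reassoc_of% h, famUnit_famMult]
  assoc := by
    change P.preCat.m₁ ≫ P.pair ≫ B.famMult P.hom = P.preCat.m₂ ≫ P.pair ≫ B.famMult P.hom
    have h₁ : P.preCat.m₁ ≫ P.pair =
        P.triple ≫ B.famMap (B.famMult P.hom) (B.famMult_tgt P.hom) := by
      apply B.fam_ext
      · rw [Category.assoc, pair_src, Category.assoc, famMap_src, reassoc_of% P.triple_src,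
          ← T.map_comp]
        exact IsPullback.lift_fst _ _ _ _
      · rw [Category.assoc, pair_arr, Category.assoc, famMap_arr, triple_arr]
        exact (IsPullback.lift_snd_assoc _ _ _ _ _).trans (Category.assoc _ _ _)
    have h₂ : P.preCat.m₂ ≫ P.pair = P.triple ≫ B.famMult (B.tgt P.hom) := by
      apply B.fam_ext
      · rw [Category.assoc, pair_src, Category.assoc, famMult_src, reassoc_of% P.triple_src,
          ← T.map_comp_assoc, pair_src]
        exact IsPullback.lift_fst _ _ _ _
      · rw [Category.assoc, pair_arr, Category.assoc, famMult_arr, comp_compose]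
        refine (IsPullback.lift_snd_assoc _ _ _ _ _).trans ?_
        change (P.pointed.c₂ ≫ P.pair ≫ B.famMult P.hom) ≫ B.arr P.hom = _
        simp only [Category.assoc, famMult_arr, comp_compose]
        apply compose_congr
        · have := P.pointed.isPullback_A₃.w
          rw [reassoc_of% P.pair_src, reassoc_of% P.triple_src, ← T.map_comp, pair_arr,
            T.map_comp, reassoc_of% this]
        · rw [pair_arr, triple_arr]
    rw [reassoc_of% h₁, reassoc_of% h₂, famMult_famMult]

/-- The projection from the `T`-category of elements of an action. -/
def proj : TFunctor P.total B where
  f₀ := P.hom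
  f₁ := B.arr P.hom
  d₀_comm := (B.fam_w P.hom).symm
  c₀_comm := P.act_hom.symm
  map_i := B.famUnit_arr P.hom
  map_m := by
    change (P.pair ≫ B.famMult P.hom) ≫ B.arr P.hom = _
    rw [Category.assoc, famMult_arr, comp_compose, compose]
    congr 1
    apply B.isPullback_A₂.hom_ext
    · rw [IsPullback.lift_fst, reassoc_of% P.pair_src]
      exact (IsPullback.lift_fst _ _ _ _).symm
    · rw [IsPullback.lift_snd, pair_arr]
      exact (IsPullback.lift_snd _ _ _ _).symm

theorem perfect_proj : perfect T (X := P.total) (Y := B) P.proj :=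
  B.isPullback_fam P.hom

end Action

/-! ### Reflexive coequalizers over `B₀` -/

section Coequalizer

theorem epi_of_nonempty_isColimit {D : Type u} [Category.{v} D] {X Y Q : D} {k l : X ⟶ Y}
    {q : Y ⟶ Q} {w : k ≫ q = l ≫ q}
    (h : Nonempty (IsColimit (Cofork.ofπ q w))) : Epi q :=
  ⟨fun _ _ e => Cofork.IsColimit.hom_ext h.some e⟩

theorem isReflexivePair_famMap (B : TCat T) {X Y : C} {x : X ⟶ B.A₀} {y : Y ⟶ B.A₀} (k l : X ⟶ Y)
    (hk : k ≫ y = x) (hl : l ≫ y = x) [IsReflexivePair k l] :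
    IsReflexivePair (B.famMap k hk) (B.famMap l hl) :=
  .mk' (B.famMap (commonSection k l) (by rw [← hk, reassoc_of% section_comp_left k l]))
    (by rw [B.famMap_comp, B.famMap_id _ _ (section_comp_left k l)])
    (by rw [B.famMap_comp, B.famMap_id _ _ (section_comp_right k l)])

variable [Monad.PreservesColimitOfIsReflexivePair (T : C ⥤ C)] (B : TCat T)

/-- The functor `B.fam` preserves reflexive coequalizers of objects over `B₀`: so does `T`, and
these coequalizers are stable under pullback along `d₀`. -/
theorem nonempty_isColimit_famMap (hstable : ReflexiveCoequalizersStableUnderPullback C)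
    {X Y Q : C} {x : X ⟶ B.A₀} {y : Y ⟶ B.A₀} {z : Q ⟶ B.A₀} (k l : X ⟶ Y) (q : Y ⟶ Q)
    (hk : k ≫ y = x) (hl : l ≫ y = x) (hq : q ≫ z = y) [IsReflexivePair k l] (w : k ≫ q = l ≫ q)
    (hc : IsColimit (Cofork.ofπ q w)) :
    Nonempty (IsColimit (Cofork.ofπ (f := B.famMap k hk) (g := B.famMap l hl) (B.famMap q hq)
      (by simp only [famMap_comp, w]))) := by
  have hT := isColimitCoforkMapOfIsColimit (T : C ⥤ C) w hc
  have : IsReflexivePair (T.map k) (T.map l) :=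
    .mk' (T.map (commonSection k l)) (by rw [← T.map_comp, section_comp_left, T.map_id])
      (by rw [← T.map_comp, section_comp_right, T.map_id])
  have sq : ∀ {X' Y' : C} {x' : X' ⟶ B.A₀} {y' : Y' ⟶ B.A₀} (g : X' ⟶ Y') (hg : g ≫ y' = x'),
      IsPullback (B.famMap g hg) (B.src x') (B.src y') (T.map g) := by
    intro X' Y' x' y' g hg
    refine IsPullback.of_right ?_ (B.famMap_src g hg) (B.isPullback_fam y').flip
    simpa [← T.map_comp, hg] using (B.isPullback_fam x').flip
  refine hstable (T.map k) (T.map l) _ hT _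
    (parallelPairHom (B.famMap k hk) (B.famMap l hl) (T.map k) (T.map l) (B.src x) (B.src y)
      (B.famMap_src k hk) (B.famMap_src l hl)) (B.src z) ?_ ?_ ?_
  · ext (_ | _)
    · change B.src x ≫ T.map k ≫ T.map q = (B.famMap k hk ≫ B.famMap q hq) ≫ B.src z
      rw [Category.assoc, famMap_src, famMap_src_assoc]
    · exact (B.famMap_src q hq).symm
  · rintro _ _ (_ | _ | _)
    · exact sq k hk
    · exact sq l hl
    · rename_i j
      change IsPullback (CategoryTheory.Functor.map _ (𝟙 j)) _ _
        (CategoryTheory.Functor.map _ (𝟙 j))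
      exact .of_horiz_isIso ⟨by simp⟩
  · rintro (_ | _)
    · exact (sq k hk).paste_horiz (sq q hq)
    · exact sq q hq

end Coequalizer

end TCat

/-! ### The free action generated by a `T`-functor -/

namespace TFunctor

variable {A B : TCat T} (f : TFunctor A B)

/-- A morphism of `A` as its domain together with its image in `B`. -/
def graph : A.A₁ ⟶ B.fam f.f₀ := B.famLift f.f₀ A.d₀ f.f₁ f.d₀_comm.symm

theorem graph_src : f.graph ≫ B.src f.f₀ = A.d₀ := B.famLift_src _ _ _ _

theorem graph_arr : f.graph ≫ B.arr f.f₀ = f.f₁ := B.famLift_arr _ _ _ _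

theorem graph_tgt : f.graph ≫ B.tgt f.f₀ = A.c₀ ≫ f.f₀ := by
  rw [TCat.tgt, reassoc_of% f.graph_arr, f.c₀_comm]

theorem i_graph : A.i ≫ f.graph = B.famUnit f.f₀ := by
  apply B.fam_ext
  · rw [Category.assoc, graph_src, A.i_d₀, B.famUnit_src]
  · rw [Category.assoc, graph_arr, f.map_i, B.famUnit_arr]

/-- Sends a family `α` of morphisms of `A` and a morphism `β` of `B` with domain the codomains of
`f α` to the pair of the codomains of `α` and `β`. -/
def relCod : B.fam (A.c₀ ≫ f.f₀) ⟶ B.fam f.f₀ := B.famMap A.c₀ rfl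

/-- Sends a family `α` of morphisms of `A` and a morphism `β` of `B` with domain the codomains of
`f α` to the pair of the domains of `α` and the composite of `f α` and `β`. -/
def relDom : B.fam (A.c₀ ≫ f.f₀) ⟶ B.fam f.f₀ := B.famMap f.graph f.graph_tgt ≫ B.famMult f.f₀

theorem relCod_tgt : f.relCod ≫ B.tgt f.f₀ = B.tgt (A.c₀ ≫ f.f₀) := B.famMap_tgt _ _

theorem relDom_src : f.relDom ≫ B.src f.f₀ = B.src (A.c₀ ≫ f.f₀) ≫ T.map A.d₀ ≫ T.μ.app A.A₀ := by
  rw [relDom, Category.assoc, B.famMult_src, B.famMap_src_assoc, ← T.map_comp_assoc, graph_src]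

theorem relDom_arr :
    f.relDom ≫ B.arr f.f₀ =
      B.compose (B.src (A.c₀ ≫ f.f₀) ≫ T.map f.f₁) (B.arr (A.c₀ ≫ f.f₀)) (by
        rw [Category.assoc, ← T.map_comp, f.c₀_comm, B.fam_w]) := by
  rw [relDom, Category.assoc, B.famMult_arr, B.comp_compose]
  apply B.compose_congr
  · rw [B.famMap_src_assoc, ← T.map_comp, graph_arr]
  · rw [B.famMap_arr]

theorem relDom_tgt : f.relDom ≫ B.tgt f.f₀ = B.tgt (A.c₀ ≫ f.f₀) := by
  rw [relDom, Category.assoc, B.famMult_tgt, B.famMap_tgt]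

theorem famMap_relCod_famMult :
    B.famMap f.relCod f.relCod_tgt ≫ B.famMult f.f₀ = B.famMult _ ≫ f.relCod :=
  B.famMult_naturality A.c₀ rfl

/-- `f.relDom` is a morphism of free algebras. For `f.relCod` this is naturality of the
multiplication. -/
theorem famMap_relDom_famMult :
    B.famMap f.relDom f.relDom_tgt ≫ B.famMult f.f₀ = B.famMult _ ≫ f.relDom := by
  have h : B.famMap f.relDom f.relDom_tgt =
      B.famMap (B.famMap f.graph f.graph_tgt) (B.famMap_tgt _ _) ≫
        B.famMap (B.famMult f.f₀) (B.famMult_tgt _) :=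
    (B.famMap_comp _ _ _ _).symm
  rw [h, Category.assoc, B.famMult_famMult, relDom,
    ← reassoc_of% B.famMult_naturality f.graph f.graph_tgt]

-- The common section inserts identities of `A`.
instance : IsReflexivePair f.relCod f.relDom :=
  .mk' (B.famMap A.i (by rw [reassoc_of% A.i_c₀]))
    (by rw [relCod, B.famMap_comp, B.famMap_id _ _ A.i_c₀])
    (by rw [relDom, reassoc_of% B.famMap_comp, B.famMap_congr f.i_graph,
      B.famMap_famUnit_famMult])

variable [HasReflexiveCoequalizers C]

/-- The object of connected components of the comma objects of `f`: families of objects of `A`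
with a morphism of `B` out of their images, where families connected by morphisms of `A` are
identified. -/
def components : C :=
  haveI := HasReflexiveCoequalizers.has_coeq f.relCod f.relDom
  coequalizer f.relCod f.relDom

/-- The class of a family of objects of `A` with a morphism of `B` out of their images. -/
def cls : B.fam f.f₀ ⟶ f.components :=
  haveI := HasReflexiveCoequalizers.has_coeq f.relCod f.relDom
  coequalizer.π f.relCod f.relDom

theorem cls_condition : f.relCod ≫ f.cls = f.relDom ≫ f.cls :=
  haveI := HasReflexiveCoequalizers.has_coeq f.relCod f.relDom
  coequalizer.condition f.relCod f.relDom

/-- `f.cls` is the coequalizer of `f.relCod` and `f.relDom`. -/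
def clsIsColimit : IsColimit (Cofork.ofπ f.cls f.cls_condition) :=
  haveI := HasReflexiveCoequalizers.has_coeq f.relCod f.relDom
  coequalizerIsCoequalizer f.relCod f.relDom

/-- The morphism out of `f.components` induced by a morphism that is compatible with the morphisms
of `A`. -/
def componentsDesc {S : C} (g : B.fam f.f₀ ⟶ S) (h : f.relCod ≫ g = f.relDom ≫ g) :
    f.components ⟶ S :=
  Cofork.IsColimit.desc f.clsIsColimit g h

theorem cls_componentsDesc {S : C} (g : B.fam f.f₀ ⟶ S) (h : f.relCod ≫ g = f.relDom ≫ g) :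
    f.cls ≫ f.componentsDesc g h = g :=
  Cofork.IsColimit.π_desc' f.clsIsColimit g h

instance : Epi f.cls := TCat.epi_of_nonempty_isColimit ⟨f.clsIsColimit⟩

/-- The structure morphism of `f.components` over `B₀`. -/
def componentsHom : f.components ⟶ B.A₀ :=
  f.componentsDesc (B.tgt f.f₀) (by rw [relCod_tgt, relDom_tgt])

theorem cls_componentsHom : f.cls ≫ f.componentsHom = B.tgt f.f₀ := f.cls_componentsDesc _ _

/-- The object part of the initial factor: an object of `A` is sent to the class of the identity on
its image. -/
def gen : A.A₀ ⟶ f.components := B.famUnit f.f₀ ≫ f.cls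

theorem gen_hom : f.gen ≫ f.componentsHom = f.f₀ := by
  rw [gen, Category.assoc, cls_componentsHom, B.famUnit_tgt]

/-- The domain of a morphism `α` of `A`, together with `f α`, has the same class as the codomain of
`α`, together with an identity. -/
theorem graph_cls : f.graph ≫ f.cls = A.c₀ ≫ f.gen := by
  have h := B.famUnit (A.c₀ ≫ f.f₀) ≫= f.cls_condition
  rw [relCod, relDom, reassoc_of% B.famUnit_naturality A.c₀ rfl, Category.assoc,
    reassoc_of% B.famUnit_naturality f.graph f.graph_tgt, reassoc_of% B.famUnit_famMult] at h
  exact h.symm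

variable [Monad.PreservesColimitOfIsReflexivePair (T : C ⥤ C)]

/-- The image of the presentation of `f.components` under the functor `B.fam`. -/
theorem nonempty_isColimit_famMap_cls (hstable : ReflexiveCoequalizersStableUnderPullback C) :
    Nonempty (IsColimit (Cofork.ofπ (f := B.famMap f.relCod f.relCod_tgt)
      (g := B.famMap f.relDom f.relDom_tgt) (B.famMap f.cls f.cls_componentsHom)
      (by simp only [B.famMap_comp, f.cls_condition]))) :=
  B.nonempty_isColimit_famMap hstable _ _ _ _ _ _ _ f.clsIsColimit

/-- The action of the morphisms of `B` on `f.components` by composition. It is defined on the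
coequalizer `B.fam f.componentsHom`. -/
def componentsAct (hstable : ReflexiveCoequalizersStableUnderPullback C) :
    B.fam f.componentsHom ⟶ f.components :=
  Cofork.IsColimit.desc (f.nonempty_isColimit_famMap_cls hstable).some (B.famMult f.f₀ ≫ f.cls) (by
    rw [reassoc_of% f.famMap_relCod_famMult, reassoc_of% f.famMap_relDom_famMult, f.cls_condition])

theorem famMap_cls_componentsAct (hstable : ReflexiveCoequalizersStableUnderPullback C) :
    B.famMap f.cls f.cls_componentsHom ≫ f.componentsAct hstable = B.famMult f.f₀ ≫ f.cls :=
  Cofork.IsColimit.π_desc' (f.nonempty_isColimit_famMap_cls hstable).some _ _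

theorem epi_famMap_cls (hstable : ReflexiveCoequalizersStableUnderPullback C) :
    Epi (B.famMap f.cls f.cls_componentsHom) :=
  TCat.epi_of_nonempty_isColimit (f.nonempty_isColimit_famMap_cls hstable)

/-- The image under `B.fam` of the pair presenting `f.components` is again reflexive, so `B.fam` may
be applied a second time. -/
theorem epi_famMap_famMap_cls (hstable : ReflexiveCoequalizersStableUnderPullback C) :
    Epi (B.famMap (B.famMap f.cls f.cls_componentsHom) (B.famMap_tgt _ _)) := by
  have := B.isReflexivePair_famMap f.relCod f.relDom f.relCod_tgt f.relDom_tgt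
  exact TCat.epi_of_nonempty_isColimit (B.nonempty_isColimit_famMap hstable _ _ _
    (B.famMap_tgt _ _) (B.famMap_tgt _ _) (B.famMap_tgt _ _) _
    (f.nonempty_isColimit_famMap_cls hstable).some)

theorem componentsAct_hom (hstable : ReflexiveCoequalizersStableUnderPullback C) :
    f.componentsAct hstable ≫ f.componentsHom = B.tgt f.componentsHom := by
  have := f.epi_famMap_cls hstable
  rw [← cancel_epi (B.famMap f.cls f.cls_componentsHom), reassoc_of% f.famMap_cls_componentsAct,
    cls_componentsHom, B.famMult_tgt, B.famMap_tgt]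

/-- The action of `B` generated by the objects of `A`, subject to the relations given by the
morphisms of `A`. -/
def freeAction (hstable : ReflexiveCoequalizersStableUnderPullback C) :
    B.Action where
  pt := f.components
  hom := f.componentsHom
  act := f.componentsAct hstable
  act_hom := f.componentsAct_hom hstable
  unit_act := by
    rw [← cancel_epi f.cls, ← reassoc_of% B.famUnit_naturality f.cls f.cls_componentsHom,
      famMap_cls_componentsAct, reassoc_of% B.famUnit_famMult, Category.comp_id]
  mult_act := by
    have := f.epi_famMap_famMap_cls hstable
    rw [← cancel_epi (B.famMap (B.famMap f.cls f.cls_componentsHom) (B.famMap_tgt _ _)),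
      reassoc_of% B.famMult_naturality f.cls f.cls_componentsHom, famMap_cls_componentsAct,
      reassoc_of% B.famMap_comp,
      B.famMap_congr (f.famMap_cls_componentsAct hstable), ← reassoc_of% B.famMult_famMult,
      ← B.famMap_comp _ (B.famMult_tgt _) f.cls f.cls_componentsHom, Category.assoc,
      famMap_cls_componentsAct]

/-! ### The comprehensive factorization of a `T`-functor -/

/-- The perfect part of the comprehensive factorization of `f`. -/
abbrev factorPerfect (hstable : ReflexiveCoequalizersStableUnderPullback C) :
    TFunctor (f.freeAction hstable).total B := (f.freeAction hstable).proj

/-- Every element of `f.components` is obtained by acting on generators. -/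
theorem famMap_gen_componentsAct (hstable : ReflexiveCoequalizersStableUnderPullback C) :
    B.famMap f.gen f.gen_hom ≫ f.componentsAct hstable = f.cls := by
  have h : B.famMap f.gen f.gen_hom =
      B.famMap (B.famUnit f.f₀) (B.famUnit_tgt _) ≫ B.famMap f.cls f.cls_componentsHom :=
    (B.famMap_comp _ _ _ _).symm
  rw [h, Category.assoc, famMap_cls_componentsAct, reassoc_of% B.famMap_famUnit_famMult]

/-- The initial part of the comprehensive factorization of `f`. -/
def factorInitial (hstable : ReflexiveCoequalizersStableUnderPullback C) :
    TFunctor A (f.freeAction hstable).total :=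
  TCat.functorOfPerfect (n := f.factorPerfect hstable) (f.freeAction hstable).perfect_proj f
    { f₀ := f.gen
      f₁ := f.graph ≫ B.famMap f.gen f.gen_hom
      d₀_comm := by
        change (f.graph ≫ B.famMap f.gen f.gen_hom) ≫ B.src f.componentsHom = _
        rw [Category.assoc, B.famMap_src, reassoc_of% f.graph_src]
        rfl
      c₀_comm := by
        change (f.graph ≫ B.famMap f.gen f.gen_hom) ≫ f.componentsAct hstable = _
        rw [Category.assoc, famMap_gen_componentsAct, graph_cls]
        rfl }
    f.gen_hom
    (by
      change (f.graph ≫ B.famMap f.gen f.gen_hom) ≫ B.arr f.componentsHom = _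
      rw [Category.assoc, B.famMap_arr, graph_arr])

theorem factorInitial_comp_factorPerfect (hstable : ReflexiveCoequalizersStableUnderPullback C) :
    (f.factorInitial hstable).comp (f.factorPerfect hstable) = f := by
  apply TFunctor.ext
  · exact f.gen_hom
  · change (f.graph ≫ B.famMap f.gen f.gen_hom) ≫ B.arr f.componentsHom = _
    rw [Category.assoc, B.famMap_arr, graph_arr]

end TFunctor

/-! ### A criterion for initiality -/

namespace TFunctor

section Diagonal

variable {A B Z W : TCat T} (f : TFunctor A B) {n : TFunctor Z W} (hn : perfect T n)
  (a : TFunctor A Z) (b : TFunctor B W) (comm : f.comp b = a.comp n)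

/-- For a commutative square with `n` perfect, the lift to `Z` of the image in `W` of a morphism of
`B` out of the image of a family of objects of `A`. -/
def liftArr : B.fam f.f₀ ⟶ Z.A₁ :=
  IsPullback.lift hn (B.src f.f₀ ≫ T.map a.f₀) (B.arr f.f₀ ≫ b.f₁) (by
    have h : f.f₀ ≫ b.f₀ = a.f₀ ≫ n.f₀ := congrArg (fun k : TFunctor A W => k.f₀) comm
    rw [Category.assoc, Category.assoc, ← T.map_comp, ← h, b.d₀_comm, T.map_comp,
      reassoc_of% B.fam_w])

theorem liftArr_d₀ : f.liftArr hn a b comm ≫ Z.d₀ = B.src f.f₀ ≫ T.map a.f₀ :=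
  IsPullback.lift_fst hn _ _ _

theorem liftArr_f₁ : f.liftArr hn a b comm ≫ n.f₁ = B.arr f.f₀ ≫ b.f₁ :=
  IsPullback.lift_snd hn _ _ _

/-- Lifts are compatible with precomposition by morphisms of `A`. -/
theorem relDom_liftArr :
    f.relDom ≫ f.liftArr hn a b comm =
      Z.compose (B.src (A.c₀ ≫ f.f₀) ≫ T.map a.f₁) (f.relCod ≫ f.liftArr hn a b comm) (by
        rw [Category.assoc, Category.assoc, liftArr_d₀, relCod, B.famMap_src_assoc, ← T.map_comp,
          ← T.map_comp, a.c₀_comm]) := by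
  have h : f.f₁ ≫ b.f₁ = a.f₁ ≫ n.f₁ := congrArg (fun k : TFunctor A W => k.f₁) comm
  apply TCat.perfect_hom_ext hn
  · have hμ := T.μ.naturality a.f₀
    simp only [Functor.comp_map] at hμ
    rw [Z.compose_d₀, Category.assoc, liftArr_d₀, reassoc_of% f.relDom_src, ← hμ]
    simp only [Category.assoc, ← T.map_comp_assoc, a.d₀_comm]
  · rw [Category.assoc, liftArr_f₁, reassoc_of% f.relDom_arr, B.compose_map, Z.compose_map]
    apply W.compose_congr
    · rw [Category.assoc, Category.assoc, ← T.map_comp, ← T.map_comp, h]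
    · rw [Category.assoc, liftArr_f₁, relCod, B.famMap_arr_assoc]

theorem famUnit_liftArr : B.famUnit f.f₀ ≫ f.liftArr hn a b comm = a.f₀ ≫ Z.i := by
  have h : f.f₀ ≫ b.f₀ = a.f₀ ≫ n.f₀ := congrArg (fun k : TFunctor A W => k.f₀) comm
  apply TCat.perfect_hom_ext hn
  · rw [Category.assoc, liftArr_d₀, B.famUnit_src_assoc, Category.assoc, Z.i_d₀]
    exact (T.η.naturality a.f₀).symm
  · rw [Category.assoc, liftArr_f₁, B.famUnit_arr_assoc, b.map_i, reassoc_of% h, Category.assoc,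
      n.map_i]

/-- Any diagonal restricts to the lift; this gives uniqueness of the diagonal. -/
theorem arr_comp_eq_liftArr (w : TFunctor B Z) (h₁ : f.comp w = a) (h₂ : w.comp n = b) :
    B.arr f.f₀ ≫ w.f₁ = f.liftArr hn a b comm := by
  subst h₁ h₂
  apply TCat.perfect_hom_ext hn
  · rw [Category.assoc, w.d₀_comm, ← reassoc_of% B.fam_w, ← T.map_comp, liftArr_d₀]
    rfl
  · rw [Category.assoc, liftArr_f₁]
    rfl

theorem relCod_liftArr_c₀ :
    f.relCod ≫ f.liftArr hn a b comm ≫ Z.c₀ = f.relDom ≫ f.liftArr hn a b comm ≫ Z.c₀ := by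
  rw [reassoc_of% f.relDom_liftArr hn a b comm, Z.compose_c₀, Category.assoc]

end Diagonal

variable [Monad.PreservesColimitOfIsReflexivePair (T : C ⥤ C)]

/-- Up to the isomorphism of `B.fam (𝟙 B₀)` with `B₁`, this epimorphism is the image under `B.fam`
of the given coequalizer. -/
theorem epi_arr_tgt (hstable : ReflexiveCoequalizersStableUnderPullback C) {A B : TCat T}
    (f : TFunctor A B)
    (hrel : f.relCod ≫ B.tgt f.f₀ = f.relDom ≫ B.tgt f.f₀)
    (hc : IsColimit (Cofork.ofπ (B.tgt f.f₀) hrel)) : Epi (B.arr (B.tgt f.f₀)) := by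
  have := TCat.epi_of_nonempty_isColimit (B.nonempty_isColimit_famMap hstable f.relCod f.relDom
    (B.tgt f.f₀) f.relCod_tgt f.relDom_tgt (Category.comp_id _) hrel hc)
  have : IsIso (B.arr (𝟙 B.A₀)) := by
    have : IsIso (T.map (𝟙 B.A₀)) := by rw [T.map_id]; infer_instance
    exact (B.isPullback_fam (𝟙 B.A₀)).isIso_snd_of_isIso
  rw [← B.famMap_arr (y := 𝟙 B.A₀) (B.tgt f.f₀) (Category.comp_id _)]
  infer_instance

/-- The diagonal filler of a square with perfect right-hand side. On objects it sends the codomain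
of a morphism out of the image of a family of objects of `A` to the codomain of its lift. -/
theorem existsUnique_diagonal (hstable : ReflexiveCoequalizersStableUnderPullback C)
    {A B Z W : TCat T} (f : TFunctor A B) {n : TFunctor Z W} (hn : perfect T n)
    (a : TFunctor A Z) (b : TFunctor B W) (comm : f.comp b = a.comp n)
    (hrel : f.relCod ≫ B.tgt f.f₀ = f.relDom ≫ B.tgt f.f₀)
    (hc : IsColimit (Cofork.ofπ (B.tgt f.f₀) hrel)) :
    ∃! w : TFunctor B Z, f.comp w = a ∧ w.comp n = b := by
  have epi₀ : Epi (B.tgt f.f₀) := TCat.epi_of_nonempty_isColimit ⟨hc⟩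
  have epi₁ := epi_arr_tgt hstable f hrel hc
  obtain ⟨w₀, hw₀⟩ : ∃ w₀ : B.A₀ ⟶ Z.A₀, B.tgt f.f₀ ≫ w₀ = f.liftArr hn a b comm ≫ Z.c₀ :=
    ⟨_, Cofork.IsColimit.π_desc' hc _ (f.relCod_liftArr_c₀ hn a b comm)⟩
  have hwn : w₀ ≫ n.f₀ = b.f₀ := by
    rw [← cancel_epi (B.tgt f.f₀), reassoc_of% hw₀, ← n.c₀_comm,
      reassoc_of% f.liftArr_f₁ hn a b comm, b.c₀_comm, TCat.tgt, Category.assoc]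
  obtain ⟨w₁, hd, hwn₁⟩ : ∃ w₁ : B.A₁ ⟶ Z.A₁, w₁ ≫ Z.d₀ = B.d₀ ≫ T.map w₀ ∧ w₁ ≫ n.f₁ = b.f₁ :=
    ⟨IsPullback.lift hn _ _ (by rw [Category.assoc, ← T.map_comp, hwn, b.d₀_comm]),
      IsPullback.lift_fst hn _ _ _, IsPullback.lift_snd hn _ _ _⟩
  -- Lifting a composite is composing the lift with the image under `w₁`.
  have hmult : B.famMult f.f₀ ≫ f.liftArr hn a b comm =
      Z.compose (B.src (B.tgt f.f₀) ≫ T.map (f.liftArr hn a b comm)) (B.arr (B.tgt f.f₀) ≫ w₁) (by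
        rw [Category.assoc, Category.assoc, hd, ← T.map_comp, ← hw₀, T.map_comp,
          reassoc_of% B.fam_w]) := by
    apply TCat.perfect_hom_ext hn
    · have hμ := T.μ.naturality a.f₀
      simp only [Functor.comp_map] at hμ
      rw [Category.assoc, liftArr_d₀, B.famMult_src_assoc, Z.compose_d₀, ← hμ]
      simp only [Category.assoc, ← T.map_comp_assoc, liftArr_d₀]
    · rw [Category.assoc, liftArr_f₁, B.famMult_arr_assoc, B.compose_map, Z.compose_map]
      apply W.compose_congr
      · rw [Category.assoc, Category.assoc, ← T.map_comp, ← T.map_comp, liftArr_f₁]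
      · rw [Category.assoc, hwn₁]
  have hc₀ : w₁ ≫ Z.c₀ = B.c₀ ≫ w₀ := by
    have h := hmult =≫ Z.c₀
    rw [Z.compose_c₀, Category.assoc, ← hw₀, reassoc_of% B.famMult_tgt, Category.assoc] at h
    rw [← cancel_epi (B.arr (B.tgt f.f₀)), ← h]
    exact Category.assoc _ _ _
  have hfw : f.f₀ ≫ w₀ = a.f₀ := by
    have h := B.famUnit f.f₀ ≫= hw₀
    rwa [reassoc_of% B.famUnit_tgt, reassoc_of% f.famUnit_liftArr hn a b comm, Z.i_c₀,
      Category.comp_id] at h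
  refine ⟨TCat.functorOfPerfect hn b ⟨w₀, w₁, hd, hc₀⟩ hwn hwn₁, ⟨?_, ?_⟩, ?_⟩
  · apply TFunctor.ext
    · exact hfw
    · apply TCat.perfect_hom_ext hn
      · change (f.f₁ ≫ w₁) ≫ Z.d₀ = _
        rw [Category.assoc, hd, reassoc_of% f.d₀_comm, ← T.map_comp, hfw, a.d₀_comm]
      · change (f.f₁ ≫ w₁) ≫ n.f₁ = _
        rw [Category.assoc, hwn₁]
        exact congrArg (fun k : TFunctor A W => k.f₁) comm
  · exact TFunctor.ext hwn hwn₁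
  · rintro w ⟨h₁, h₂⟩
    have e₀ : w.f₀ = w₀ := by
      rw [← cancel_epi (B.tgt f.f₀), hw₀, ← f.arr_comp_eq_liftArr hn a b comm w h₁ h₂,
        Category.assoc, w.c₀_comm, TCat.tgt, Category.assoc]
    refine TFunctor.ext e₀ (TCat.perfect_hom_ext hn ?_ ?_)
    · rw [w.d₀_comm, e₀]
      exact hd.symm
    · exact (congrArg (fun k : TFunctor B W => k.f₁) h₂).trans hwn₁.symm

/-- A `T`-functor `f : A ⟶ B` is initial if the codomain morphism exhibits `B₀` as the coequalizer
of `f.relCod` and `f.relDom`. For ordinary categories (`T = 1`) this says that for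
each object `b` of `B` the comma category of `f` over `b` is connected. -/
theorem initial_of_isColimit (hstable : ReflexiveCoequalizersStableUnderPullback C) {A B : TCat T}
    (f : TFunctor A B) (hrel : f.relCod ≫ B.tgt f.f₀ = f.relDom ≫ B.tgt f.f₀)
    (hc : IsColimit (Cofork.ofπ (B.tgt f.f₀) hrel)) : initial T (X := A) (Y := B) f :=
  fun _ _ _ hn a b comm => existsUnique_diagonal hstable f hn a b comm hrel hc

end TFunctor

/-! ### Initiality of the first factor -/

namespace TCat

/-- The image under a `T`-functor of the families of morphisms of its source. -/
def famPush {P B : TCat T} (p : TFunctor P B) {X : C} {x : X ⟶ P.A₀} {y : X ⟶ B.A₀}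
    (h : x ≫ p.f₀ = y) : P.fam x ⟶ B.fam y :=
  B.famLift y (P.src x) (P.arr x ≫ p.f₁) (by
    rw [Category.assoc, p.d₀_comm, ← h, T.map_comp, reassoc_of% P.fam_w])

section FamPush

variable {P B : TCat T} (p : TFunctor P B) {X : C} {x : X ⟶ P.A₀} {y : X ⟶ B.A₀}
  (h : x ≫ p.f₀ = y)

theorem famPush_src : famPush p h ≫ B.src y = P.src x := B.famLift_src _ _ _ _

theorem famPush_arr : famPush p h ≫ B.arr y = P.arr x ≫ p.f₁ := B.famLift_arr _ _ _ _

/-- A perfect `T`-functor `p` lifts morphisms uniquely along `d₀`, so families over `x` and over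
`x ≫ p₀` agree. -/
theorem isIso_famPush (hp : perfect T p) : IsIso (famPush p h) := by
  have sq : IsPullback (P.src x) (P.arr x ≫ p.f₁) (T.map y) B.d₀ := by
    rw [← h, T.map_comp]
    exact ((P.isPullback_fam x).flip.paste_horiz (IsPullback.flip hp)).flip
  have e : famPush p h = (sq.isoIsPullback _ _ (B.isPullback_fam y)).hom := by
    apply B.fam_ext
    · rw [famPush_src, IsPullback.isoIsPullback_hom_fst]
    · rw [famPush_arr, IsPullback.isoIsPullback_hom_snd]
  rw [e]
  infer_instance

end FamPush

end TCat

/-- Coequalizers are invariant under isomorphism of the coequalized pair. -/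
theorem nonempty_isColimit_cofork_of_isIso {D : Type u} [Category.{v} D] {X Y X' Y' Q : D}
    {k l : X ⟶ Y} {q : Y ⟶ Q} {w : k ≫ q = l ≫ q} (hc : IsColimit (Cofork.ofπ q w))
    {k' l' : X' ⟶ Y'} {q' : Y' ⟶ Q} (ψ : X' ⟶ X) [IsIso ψ] (φ : Y' ⟶ Y) [IsIso φ]
    (hk : k' ≫ φ = ψ ≫ k) (hl : l' ≫ φ = ψ ≫ l) (hq : φ ≫ q = q') (w' : k' ≫ q' = l' ≫ q') :
    Nonempty (IsColimit (Cofork.ofπ q' w')) := by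
  have h (s : Cofork k' l') : k ≫ inv φ ≫ s.π = l ≫ inv φ ≫ s.π := by
    rw [← cancel_epi ψ, ← Category.assoc, ← hk, ← Category.assoc ψ, ← hl, Category.assoc,
      Category.assoc, IsIso.hom_inv_id_assoc, s.condition]
  refine ⟨Cofork.IsColimit.mk' _ fun s => ⟨Cofork.IsColimit.desc hc (inv φ ≫ s.π) (h s), ?_, ?_⟩⟩
  · change q' ≫ _ = s.π
    rw [← hq, Category.assoc]
    exact (φ ≫= Cofork.IsColimit.π_desc' hc _ (h s)).trans (IsIso.hom_inv_id_assoc _ _)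
  · intro m hm
    apply Cofork.IsColimit.hom_ext hc
    refine Eq.trans ?_ (Cofork.IsColimit.π_desc' hc _ (h s)).symm
    change q ≫ m = inv φ ≫ s.π
    rw [← hm, IsIso.eq_inv_comp, ← Category.assoc, hq]
    rfl

namespace TFunctor

section Comp

variable {A P B : TCat T} (e : TFunctor A P) (p : TFunctor P B) (f : TFunctor A B)
  (h₀ : e.f₀ ≫ p.f₀ = f.f₀)

theorem relCod_famPush :
    e.relCod ≫ TCat.famPush p h₀ =
      TCat.famPush p (show (A.c₀ ≫ e.f₀) ≫ p.f₀ = A.c₀ ≫ f.f₀ by rw [Category.assoc, h₀]) ≫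
        f.relCod := by
  apply B.fam_ext
  · rw [Category.assoc, TCat.famPush_src, Category.assoc, relCod, relCod, B.famMap_src,
      P.famMap_src, reassoc_of% TCat.famPush_src]
  · rw [Category.assoc, TCat.famPush_arr, Category.assoc, relCod, relCod, B.famMap_arr,
      P.famMap_arr_assoc, TCat.famPush_arr]

theorem relDom_famPush (h₁ : e.f₁ ≫ p.f₁ = f.f₁) :
    e.relDom ≫ TCat.famPush p h₀ =
      TCat.famPush p (show (A.c₀ ≫ e.f₀) ≫ p.f₀ = A.c₀ ≫ f.f₀ by rw [Category.assoc, h₀]) ≫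
        f.relDom := by
  apply B.fam_ext
  · rw [Category.assoc, TCat.famPush_src, Category.assoc, relDom_src, relDom_src,
      reassoc_of% TCat.famPush_src]
  · rw [Category.assoc, TCat.famPush_arr, Category.assoc, relDom_arr, reassoc_of% e.relDom_arr,
      P.compose_map, B.comp_compose]
    apply B.compose_congr
    · rw [reassoc_of% TCat.famPush_src, Category.assoc, ← T.map_comp, h₁]
    · rw [TCat.famPush_arr]

end Comp

variable [HasReflexiveCoequalizers C] [Monad.PreservesColimitOfIsReflexivePair (T : C ⥤ C)]

theorem initial_factorInitial (hstable : ReflexiveCoequalizersStableUnderPullback C)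
    {A B : TCat T} (f : TFunctor A B) :
    initial T (X := A) (Y := (f.freeAction hstable).total) (f.factorInitial hstable) := by
  let P := (f.freeAction hstable).total
  let e : TFunctor A P := f.factorInitial hstable
  let p : TFunctor P B := f.factorPerfect hstable
  have h₀ : e.f₀ ≫ p.f₀ = f.f₀ := f.gen_hom
  have h₁ : e.f₁ ≫ p.f₁ = f.f₁ :=
    congrArg (fun k : TFunctor A B => k.f₁) (f.factorInitial_comp_factorPerfect hstable)
  have hp : perfect T (X := P) (Y := B) p := (f.freeAction hstable).perfect_proj
  have := TCat.isIso_famPush p h₀ hp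
  have := TCat.isIso_famPush p
    (show (A.c₀ ≫ e.f₀) ≫ p.f₀ = A.c₀ ≫ f.f₀ by rw [Category.assoc, h₀]) hp
  have hk := relCod_famPush e p f h₀
  have hl := relDom_famPush e p f h₀ h₁
  have hq : TCat.famPush p h₀ ≫ f.cls = P.tgt e.f₀ := by
    have harr : TCat.famPush p h₀ ≫ B.famMap f.gen f.gen_hom = P.arr e.f₀ := by
      apply B.fam_ext
      · rw [Category.assoc, B.famMap_src, reassoc_of% TCat.famPush_src]
        exact P.fam_w e.f₀
      · rw [Category.assoc, B.famMap_arr, TCat.famPush_arr]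
        rfl
    rw [← f.famMap_gen_componentsAct hstable]
    exact (Category.assoc _ _ _).symm.trans (harr =≫ f.componentsAct hstable)
  have hrel : e.relCod ≫ P.tgt e.f₀ = e.relDom ≫ P.tgt e.f₀ := by
    have h : e.relCod ≫ TCat.famPush p h₀ ≫ f.cls = e.relDom ≫ TCat.famPush p h₀ ≫ f.cls := by
      rw [reassoc_of% hk, reassoc_of% hl, f.cls_condition]
    rw [← hq]
    exact h
  exact initial_of_isColimit hstable e hrel
    (nonempty_isColimit_cofork_of_isIso f.clsIsColimit _ _ hk hl hq hrel).some

end TFunctor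

/-! ### Closure under isomorphisms -/

theorem leftOrthogonal_respectsIso {D : Type u} [Category.{v} D] (M : MorphismProperty D) :
    (leftOrthogonal M).RespectsIso := by
  apply MorphismProperty.RespectsIso.mk
  · intro X Y Z i f hf U V n hn a b comm
    obtain ⟨w, ⟨h₁, h₂⟩, huniq⟩ := hf n hn (i.inv ≫ a) b (by
      rw [Category.assoc, ← comm, Category.assoc, i.inv_hom_id_assoc])
    exact ⟨w, ⟨by rw [Category.assoc, h₁, i.hom_inv_id_assoc], h₂⟩, fun w' ⟨h₁', h₂'⟩ =>
      huniq w' ⟨by rw [← h₁', Category.assoc, i.inv_hom_id_assoc], h₂'⟩⟩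
  · intro X Y Z i f hf U V n hn a b comm
    obtain ⟨w, ⟨h₁, h₂⟩, huniq⟩ := hf n hn a (i.hom ≫ b) (by rw [← comm, Category.assoc])
    refine ⟨i.inv ≫ w, ⟨by rw [Category.assoc, i.hom_inv_id_assoc, h₁],
      by rw [Category.assoc, h₂, i.inv_hom_id_assoc]⟩, fun w' ⟨h₁', h₂'⟩ => ?_⟩
    rw [← huniq (i.hom ≫ w') ⟨by rw [← h₁', Category.assoc], by rw [Category.assoc, h₂']⟩,
      i.inv_hom_id_assoc]

theorem perfect_of_isIso {A B : TCat T} (i : A ≅ B) : perfect T i.hom := by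
  let f : TFunctor A B := i.hom
  let g : TFunctor B A := i.inv
  have h₁ : IsIso f.f₁ := ⟨g.f₁, congrArg (fun k : TFunctor A A => k.f₁) i.hom_inv_id,
    congrArg (fun k : TFunctor B B => k.f₁) i.inv_hom_id⟩
  have h₀ : IsIso f.f₀ := ⟨g.f₀, congrArg (fun k : TFunctor A A => k.f₀) i.hom_inv_id,
    congrArg (fun k : TFunctor B B => k.f₀) i.inv_hom_id⟩
  have : IsIso (T.map f.f₀) := inferInstanceAs (IsIso ((T : C ⥤ C).map f.f₀))
  exact IsPullback.of_vert_isIso (snd := f.f₁) (f := T.map f.f₀) ⟨f.d₀_comm.symm⟩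

theorem perfect_comp {A B E : TCat T} {f : TFunctor A B} {g : TFunctor B E}
    (hf : perfect T (X := A) (Y := B) f) (hg : perfect T (X := B) (Y := E) g) :
    perfect T (X := A) (Y := E) (f.comp g) := by
  change IsPullback A.d₀ (f.f₁ ≫ g.f₁) (T.map (f.f₀ ≫ g.f₀)) E.d₀
  rw [T.map_comp]
  exact IsPullback.paste_vert hf hg

theorem perfect_respectsIso (T : Monad C) : (perfect T).RespectsIso :=
  .mk _ (fun i _ hf => perfect_comp (perfect_of_isIso i) hf)
    (fun i _ hf => perfect_comp hf (perfect_of_isIso i))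

end

end Burroni

theorem mainTheorem1 {C : Type u} [Category.{v} C] [HasPullbacks C] [HasReflexiveCoequalizers C]
    (hstable : Burroni.ReflexiveCoequalizersStableUnderPullback C)
    (T : Monad C) [Monad.PreservesColimitOfIsReflexivePair (T : C ⥤ C)] :
    Burroni.IsOrthogonalFactorizationSystem (Burroni.initial T) (Burroni.perfect T) where
  respectsIso_left := Burroni.leftOrthogonal_respectsIso _
  respectsIso_right := Burroni.perfect_respectsIso T
  hasFactorization :=
    ⟨fun f => ⟨{
      Z := (Burroni.TFunctor.freeAction f hstable).total
      i := Burroni.TFunctor.factorInitial f hstable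
      p := Burroni.TFunctor.factorPerfect f hstable
      fac := Burroni.TFunctor.factorInitial_comp_factorPerfect f hstable
      hi := Burroni.TFunctor.initial_factorInitial hstable f
      hp := (Burroni.TFunctor.freeAction f hstable).perfect_proj }⟩⟩
  orthogonal := fun _ _ _ _ _ n he hn => he n hn
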